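/- Let $\mathcal R$ be an o-minimal expansion of the ordered field $\mathbb{R}$ of real numbers (every subset of $\mathbb{R}$ definable in $\mathcal R$ is a finite union of points and open intervals with endpoints in $\mathbb{R}\cup\{\pm\infty\}$); "definable" means definable in $\mathcal R$ with parameters. A definable graph $(V,G)$ consists of a nonempty definable set $V\subseteq\mathbb{R}^n$ and a definable symmetric antireflexive relation $G\subseteq V\times V$. A definable coloring of $(V,G)$ is a definable map $c\colon V\to X$ to a finite set $X$ (a subset of some $\mathbb{R}^m$) such that $c(v)\neq c(w)$ whenever $(v,w)\in G$. Let $\lambda$ be Lebesgue measure on $\mathbb{R}^n$. Lemma. Let $(V,G)$ be a definable graph with $V\subseteq\mathbb{R}^n$ bounded such that every vertex has finite degree. Then for every $\epsilon>0$ there is a definable set $V'\subseteq V$ with $\lambda(V\setminus V')<\epsilon$ such that the induced graph $(V',\,G\cap (V'\times V'))$ (in particular $V'\neq\emptyset$) has a definable coloring. -/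

import Mathlib

open MeasureTheory

universe u v

/-- `S ⊆ ℝ^ι` is definable in the first-order structure `ℝ` of the language `L`,
with arbitrary real parameters. -/
def IsDefinableSet (L : FirstOrder.Language.{u, v}) [L.Structure ℝ] {ι : Type} (S : Set (ι → ℝ)) : Prop :=
  (Set.univ : Set ℝ).Definable L S

/-- A binary relation `E ⊆ ℝ^n × ℝ^m` is definable if it is so as a subset of `ℝ^(n+m)`. -/
def IsDefinableRel (L : FirstOrder.Language.{u, v}) [L.Structure ℝ] {n m : ℕ}
    (E : Set ((Fin n → ℝ) × (Fin m → ℝ))) : Prop :=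
  IsDefinableSet L
    {z : Fin n ⊕ Fin m → ℝ | ((fun i => z (Sum.inl i)), (fun j => z (Sum.inr j))) ∈ E}

/-- The map `f : V → ℝ^m` (given by a function whose values off `V` are ignored) is definable,
that is, its graph is. -/
def IsDefinableMapOn (L : FirstOrder.Language.{u, v}) [L.Structure ℝ] {n m : ℕ} (V : Set (Fin n → ℝ))
    (f : (Fin n → ℝ) → (Fin m → ℝ)) : Prop :=
  IsDefinableRel L {p : (Fin n → ℝ) × (Fin m → ℝ) | p.1 ∈ V ∧ p.2 = f p.1}

/-- A point, or an open interval with endpoints in `ℝ ∪ {-∞, +∞}`. -/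
def IsPointOrOpenInterval (I : Set ℝ) : Prop :=
  (∃ a : ℝ, I = {a}) ∨ ∃ a b : EReal, I = {x : ℝ | a < (x : EReal) ∧ (x : EReal) < b}

/-- The structure that `L` puts on `ℝ` is an o-minimal expansion of the ordered field of real
numbers. The field operations and the order need not be named by symbols of `L`; it is enough that
they are definable, as they are when they are named. -/
structure IsOMinimalExpansion (L : FirstOrder.Language.{u, v}) [L.Structure ℝ] : Prop where
  definable_add : IsDefinableSet L {x : Fin 3 → ℝ | x 0 + x 1 = x 2}
  definable_mul : IsDefinableSet L {x : Fin 3 → ℝ | x 0 * x 1 = x 2}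
  definable_lt : IsDefinableSet L {x : Fin 2 → ℝ | x 0 < x 1}
  finite_union : ∀ S : Set ℝ, IsDefinableSet L {x : Fin 1 → ℝ | x 0 ∈ S} →
    ∃ F : Set (Set ℝ), F.Finite ∧ (∀ I ∈ F, IsPointOrOpenInterval I) ∧ S = ⋃₀ F

/-- `(V, E)` is a definable graph: a nonempty definable vertex set `V ⊆ ℝ^n` with a definable
symmetric antireflexive relation `E ⊆ V × V`. -/
structure IsDefinableGraph (L : FirstOrder.Language.{u, v}) [L.Structure ℝ] {n : ℕ} (V : Set (Fin n → ℝ))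
    (E : Set ((Fin n → ℝ) × (Fin n → ℝ))) : Prop where
  nonempty : V.Nonempty
  subset : E ⊆ V ×ˢ V
  symm : ∀ x y, (x, y) ∈ E → (y, x) ∈ E
  irrefl : ∀ x, (x, x) ∉ E
  definable_verts : IsDefinableSet L V
  definable_edges : IsDefinableRel L E

/-- `c : V → X` is a definable coloring of the graph `(V, E)`: a definable map to a finite set
that gives different values to adjacent vertices. -/
structure IsDefinableColoring (L : FirstOrder.Language.{u, v}) [L.Structure ℝ] {n m : ℕ}
    (V : Set (Fin n → ℝ)) (E : Set ((Fin n → ℝ) × (Fin n → ℝ)))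
    (X : Set (Fin m → ℝ)) (c : (Fin n → ℝ) → (Fin m → ℝ)) : Prop where
  finite : X.Finite
  mapsTo : Set.MapsTo c V X
  definable : IsDefinableMapOn L V c
  proper : ∀ x y, (x, y) ∈ E → c x ≠ c y

/-! Cut space into grid cells of mesh `1 / (k + 1)` and color each vertex by its cell. Since `V` is
bounded, finitely many colors occur, and the coloring is proper once the vertices having a neighbor
in their own cell are deleted. A vertex has finitely many neighbors, all different from it, so it is
deleted for only finitely many `k`. The deleted sets thus tend pointwise to the empty set inside a
set of finite measure, and their measures tend to 0 (`tendsto_volume_diff_separatedVerts`). This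
needs definable sets to be measurable (`measurableSet_of_definable`), which is shown by induction on
dimension without cell decomposition. -/

namespace OMinimal

open Set Filter Topology FirstOrder

variable {L : FirstOrder.Language.{u, v}} [L.Structure ℝ]

/-! ### Closure properties of definable sets -/

section Definability

variable {α β : Type}

/-- The preimage of a definable set under a map each of whose coordinates is a variable or a
constant is definable. -/
theorem definable_preimage_sumElim {A : Set (β → ℝ)} (hA : IsDefinableSet L A)
    (t : β → α ⊕ ℝ) :
    IsDefinableSet L {x : α → ℝ | (fun b => Sum.elim x id (t b)) ∈ A} := by
  obtain ⟨φ, rfl⟩ := hA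
  refine ⟨φ.subst (fun b => Sum.elim Language.Term.var
    (fun r => (L.con (⟨r, trivial⟩ : (univ : Set ℝ))).term) (t b)), ?_⟩
  ext x
  have h : (fun b => Sum.elim x id (t b)) = fun b => Language.Term.realize x
      (Sum.elim (Language.Term.var : α → L[[(univ : Set ℝ)]].Term α)
        (fun r => (L.con (⟨r, trivial⟩ : (univ : Set ℝ))).term) (t b)) := by
    funext b
    cases t b <;> simp
  change Language.Formula.Realize φ _ ↔ Language.BoundedFormula.Realize _ _ _
  rw [Language.BoundedFormula.realize_subst, h]
  rfl

theorem definable_lt_var (hL : IsOMinimalExpansion L) (i j : α) :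
    IsDefinableSet L {x : α → ℝ | x i < x j} :=
  definable_preimage_sumElim hL.definable_lt ![Sum.inl i, Sum.inl j]

theorem definable_lt_const (hL : IsOMinimalExpansion L) (i : α) (a : ℝ) :
    IsDefinableSet L {x : α → ℝ | x i < a} :=
  definable_preimage_sumElim hL.definable_lt ![Sum.inl i, Sum.inr a]

theorem definable_const_lt (hL : IsOMinimalExpansion L) (i : α) (a : ℝ) :
    IsDefinableSet L {x : α → ℝ | a < x i} :=
  definable_preimage_sumElim hL.definable_lt ![Sum.inr a, Sum.inl i]

theorem definable_const_le (hL : IsOMinimalExpansion L) (i : α) (a : ℝ) :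
    IsDefinableSet L {x : α → ℝ | a ≤ x i} := by
  convert! (definable_lt_const hL i a).compl using 1
  ext x
  exact (not_lt (a := x i) (b := a)).symm

theorem definable_eq_const (hL : IsOMinimalExpansion L) (i : α) (a : ℝ) :
    IsDefinableSet L {x : α → ℝ | x i = a} := by
  convert! (definable_const_le hL i a).inter (definable_const_lt hL i a).compl using 1
  ext x
  exact ⟨fun h => ⟨h.ge, h.le.not_gt⟩, fun h => le_antisymm (not_lt.mp h.2) h.1⟩

/-- The set of points of `A` lying in the interior of their fiber over the last `n` coordinates. -/
def fiberInterior {n : ℕ} (A : Set (Fin (n + 1) → ℝ)) : Set (Fin (n + 1) → ℝ) :=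
  {z | ∃ w : Fin 2 → ℝ, (w 0 < z 0 ∧ z 0 < w 1) ∧
    ∀ s : Fin 1 → ℝ, w 0 < s 0 ∧ s 0 < w 1 → (Fin.cons (s 0) (Fin.tail z) : Fin (n + 1) → ℝ) ∈ A}

theorem definable_fiberInterior (hL : IsOMinimalExpansion L) {n : ℕ} {A : Set (Fin (n + 1) → ℝ)}
    (hA : IsDefinableSet L A) : IsDefinableSet L (fiberInterior A) := by
  have h₁ : IsDefinableSet L {z : (Fin (n + 1) ⊕ Fin 2) ⊕ Fin 1 → ℝ |
      (fun b => Sum.elim z id ((Fin.cons (Sum.inl (Sum.inr 0))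
        (fun j => Sum.inl (Sum.inl (Sum.inl j.succ))) :
        Fin (n + 1) → ((Fin (n + 1) ⊕ Fin 2) ⊕ Fin 1) ⊕ ℝ) b)) ∈ A} :=
    definable_preimage_sumElim hA _
  have h₂ := ((definable_lt_var (α := (Fin (n + 1) ⊕ Fin 2) ⊕ Fin 1) hL
    (Sum.inl (Sum.inr 0)) (Sum.inr 0)).inter
    (definable_lt_var hL (Sum.inr 0) (Sum.inl (Sum.inr 1)))).compl.union h₁
  have h₃ := ((definable_lt_var (α := Fin (n + 1) ⊕ Fin 2) hL (Sum.inr 0) (Sum.inl 0)).inter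
    (definable_lt_var hL (Sum.inl 0) (Sum.inr 1))).inter h₂.forall_of_finite
  convert! h₃.exists_of_finite using 1
  ext z
  refine exists_congr fun w => and_congr Iff.rfl (forall_congr' fun s => ?_)
  refine Iff.trans (imp_iff_not_or) (or_congr Iff.rfl ?_)
  change _ ∈ A ↔ _ ∈ A
  refine iff_of_eq (congrArg (· ∈ A) ?_)
  funext b
  refine Fin.cases ?_ (fun j => ?_) b <;> simp [Fin.tail]

theorem definable_exists_cons (hL : IsOMinimalExpansion L) {n : ℕ} {A : Set (Fin (n + 1) → ℝ)}
    (hA : IsDefinableSet L A) (p q : ℝ) :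
    IsDefinableSet L {x : Fin n → ℝ | ∃ s, (p < s ∧ s < q) ∧ (Fin.cons s x : Fin (n + 1) → ℝ) ∈ A} := by
  have h := (((definable_const_lt hL 0 p).inter (definable_lt_const hL 0 q)).inter
    hA).image_comp (Fin.succ : Fin n → Fin (n + 1))
  convert! h using 1
  ext x
  constructor
  · rintro ⟨s, hs, hx⟩
    exact ⟨Fin.cons s x, ⟨hs, hx⟩, funext fun _ => rfl⟩
  · rintro ⟨z, ⟨hz, hzA⟩, rfl⟩
    exact ⟨z 0, hz, by convert hzA; exact Fin.cons_self_tail z⟩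

theorem definable_fiber {n : ℕ} {A : Set (Fin (n + 1) → ℝ)}
    (hA : IsDefinableSet L A) (x : Fin n → ℝ) :
    IsDefinableSet L {y : Fin 1 → ℝ | y 0 ∈ {s : ℝ | (Fin.cons s x : Fin (n + 1) → ℝ) ∈ A}} := by
  convert! definable_preimage_sumElim hA
    (Fin.cons (Sum.inl 0) (fun j => Sum.inr (x j)) : Fin (n + 1) → Fin 1 ⊕ ℝ) using 1
  ext y
  refine iff_of_eq (congrArg (· ∈ A) ?_)
  funext b
  refine Fin.cases ?_ (fun j => ?_) b <;> simp

end Definability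

/-! ### Borel measurability of definable sets -/

section Measurability

/-- Interval pieces of `S` are open, hence inside the interior; only the finitely many singleton
pieces can contribute. -/
theorem finite_diff_interior (hL : IsOMinimalExpansion L) {S : Set ℝ}
    (hS : IsDefinableSet L {x : Fin 1 → ℝ | x 0 ∈ S}) : (S \ interior S).Finite := by
  obtain ⟨F, hF, hI, hSF⟩ := hL.finite_union S hS
  have hfin : ((fun a : ℝ => ({a} : Set ℝ)) ⁻¹' F).Finite :=
    hF.preimage (singleton_injective.injOn)
  refine hfin.subset ?_
  rintro x ⟨hx, hxi⟩
  obtain ⟨I, hIF, hxI⟩ := mem_sUnion.mp (hSF ▸ hx)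
  rcases hI I hIF with ⟨a, rfl⟩ | ⟨a, b, rfl⟩
  · obtain rfl : x = a := hxI
    exact hIF
  · refine absurd (mem_interior.mpr ⟨_, ?_, ?_, hxI⟩) hxi
    · rw [hSF]
      exact subset_sUnion_of_mem hIF
    · exact (isOpen_Ioi.preimage continuous_coe_real_ereal).inter
        (isOpen_Iio.preimage continuous_coe_real_ereal)

theorem cons_mem_fiberInterior {n : ℕ} {A : Set (Fin (n + 1) → ℝ)} (x : Fin n → ℝ) (s : ℝ) :
    (Fin.cons s x : Fin (n + 1) → ℝ) ∈ fiberInterior A ↔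
      s ∈ interior {s : ℝ | (Fin.cons s x : Fin (n + 1) → ℝ) ∈ A} := by
  rw [mem_interior_iff_mem_nhds, mem_nhds_iff_exists_Ioo_subset]
  constructor
  · rintro ⟨w, hw, h⟩
    exact ⟨w 0, w 1, hw, fun t ht => h (fun _ => t) ht⟩
  · rintro ⟨l, r, hs, h⟩
    exact ⟨![l, r], hs, fun t ht => h ht⟩

/-- Rational intervals form a base of the line, so `A` is a countable union of products of such an
interval with one of the sets in `hm`. -/
theorem measurableSet_of_fibers_open {n : ℕ} {A : Set (Fin (n + 1) → ℝ)}
    (hA : ∀ x : Fin n → ℝ, IsOpen {s : ℝ | (Fin.cons s x : Fin (n + 1) → ℝ) ∈ A})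
    (hm : ∀ p q : ℚ, MeasurableSet {x : Fin n → ℝ | ∀ s : ℝ, ((p : ℝ) < s ∧ s < q) →
      (Fin.cons s x : Fin (n + 1) → ℝ) ∈ A}) : MeasurableSet A := by
  have htail : Measurable (Fin.tail : (Fin (n + 1) → ℝ) → Fin n → ℝ) :=
    measurable_pi_lambda _ fun i => measurable_pi_apply i.succ
  have hA' : A = ⋃ (p : ℚ) (q : ℚ), ((fun z : Fin (n + 1) → ℝ => z 0) ⁻¹' Ioo (p : ℝ) q ∩
      Fin.tail ⁻¹' {x : Fin n → ℝ | ∀ s : ℝ, ((p : ℝ) < s ∧ s < q) →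
        (Fin.cons s x : Fin (n + 1) → ℝ) ∈ A}) := by
    ext z
    simp only [mem_iUnion]
    constructor
    · intro hz
      have hz' : z 0 ∈ {s : ℝ | (Fin.cons s (Fin.tail z) : Fin (n + 1) → ℝ) ∈ A} := by
        change Fin.cons (z 0) (Fin.tail z) ∈ A
        rwa [Fin.cons_self_tail]
      obtain ⟨l, r, hlr, hsub⟩ := mem_nhds_iff_exists_Ioo_subset.mp ((hA _).mem_nhds hz')
      obtain ⟨p, hp, hp'⟩ := exists_rat_btwn hlr.1
      obtain ⟨q, hq, hq'⟩ := exists_rat_btwn hlr.2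
      exact ⟨p, q, ⟨hp', hq⟩, fun s hs => hsub ⟨hp.trans hs.1, hs.2.trans hq'⟩⟩
    · rintro ⟨p, q, hz, h⟩
      have := h (z 0) hz
      rwa [Fin.cons_self_tail] at this
  rw [hA']
  exact MeasurableSet.iUnion fun p => MeasurableSet.iUnion fun q =>
    ((measurable_pi_apply 0) measurableSet_Ioo).inter (htail (hm p q))

/-- Sets definable in an o-minimal structure are Borel. -/
theorem measurableSet_of_definable (hL : IsOMinimalExpansion L) {n : ℕ} {A : Set (Fin n → ℝ)}
    (hA : IsDefinableSet L A) : MeasurableSet A := by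
  induction n with
  | zero => exact (Set.toFinite A).measurableSet
  | succ n ih =>
    have hopen : ∀ {B : Set (Fin (n + 1) → ℝ)}, IsDefinableSet L B →
        (∀ x : Fin n → ℝ, IsOpen {s : ℝ | (Fin.cons s x : Fin (n + 1) → ℝ) ∈ B}) →
        MeasurableSet B := by
      intro B hB hBo
      refine measurableSet_of_fibers_open hBo fun p q => ?_
      -- The complement of the base set is a projection of a definable set, so the induction
      -- hypothesis applies to it.
      convert! (ih (definable_exists_cons hL hB.compl p q)).compl using 1
      ext x
      change (∀ s : ℝ, _ → _) ↔ ¬ ∃ s : ℝ, _ ∧ ¬ _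
      push Not
      rfl
    have hint := definable_fiberInterior hL hA
    have h₁ : MeasurableSet (fiberInterior A) := hopen hint fun x => by
      simp only [cons_mem_fiberInterior]
      exact isOpen_interior
    -- By o-minimality the remainder has finite fibers, so its complement has open ones.
    have h₂ : MeasurableSet (A \ fiberInterior A)ᶜ := hopen (hA.sdiff hint).compl fun x => by
      have hfin := finite_diff_interior hL (definable_fiber hA x)
      convert! hfin.isClosed.isOpen_compl using 1
      ext s
      exact not_congr (and_congr Iff.rfl (not_congr (cons_mem_fiberInterior x s)))
    have hsub : fiberInterior A ⊆ A := by
      intro z hz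
      rw [← Fin.cons_self_tail z, cons_mem_fiberInterior] at hz
      have := interior_subset hz
      change Fin.cons (z 0) (Fin.tail z) ∈ A at this
      rwa [Fin.cons_self_tail] at this
    rw [← sdiff_union_of_subset hsub]
    exact h₂.of_compl.union h₁

end Measurability

/-! ### Grid cells and the coloring -/

section Grid

variable {n : ℕ}

/-- The integer vector indexing the cell containing `x` of the grid of mesh `1 / (k + 1)`. -/
noncomputable def gridCode (k : ℕ) (x : Fin n → ℝ) : Fin n → ℤ := fun i => ⌊((k : ℝ) + 1) * x i⌋

/-- The floor function on the whole line is not definable, but each single cell is a half-open box.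
-/
theorem definable_gridCode_eq (hL : IsOMinimalExpansion L) (k : ℕ) (m : Fin n → ℤ) :
    IsDefinableSet L {x : Fin n → ℝ | gridCode k x = m} := by
  have h := definable_iInter_of_finite fun i : Fin n =>
    (definable_const_le hL i ((m i : ℝ) / (k + 1))).inter
      (definable_lt_const hL i (((m i : ℝ) + 1) / (k + 1)))
  convert! h using 1
  ext x
  have hk : (0 : ℝ) < k + 1 := by positivity
  rw [mem_iInter]
  refine Iff.trans funext_iff (forall_congr' fun i => ?_)
  change gridCode k x i = m i ↔ (m i : ℝ) / (k + 1) ≤ x i ∧ x i < ((m i : ℝ) + 1) / (k + 1)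
  rw [gridCode, Int.floor_eq_iff, div_le_iff₀' hk, lt_div_iff₀' hk]

theorem finite_gridCode_image {V : Set (Fin n → ℝ)} (hV : Bornology.IsBounded V) (k : ℕ) :
    (gridCode k '' V).Finite := by
  obtain ⟨R, hR⟩ := hV.exists_norm_le
  refine (Set.finite_Icc (fun _ : Fin n => ⌊((k : ℝ) + 1) * (-R)⌋)
    (fun _ => ⌊((k : ℝ) + 1) * R⌋)).subset ?_
  rintro _ ⟨x, hx, rfl⟩
  have h : ∀ i, |x i| ≤ R := fun i => (norm_le_pi_norm x i).trans (hR x hx)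
  exact ⟨fun i => Int.floor_le_floor (mul_le_mul_of_nonneg_left (abs_le.mp (h i)).1 (by positivity)),
    fun i => Int.floor_le_floor (mul_le_mul_of_nonneg_left (abs_le.mp (h i)).2 (by positivity))⟩

theorem eventually_gridCode_ne {x y : Fin n → ℝ} (h : x ≠ y) :
    ∀ᶠ k : ℕ in atTop, gridCode k x ≠ gridCode k y := by
  obtain ⟨i, hi⟩ := Function.ne_iff.mp h
  have hpos : 0 < |x i - y i| := abs_pos.mpr (sub_ne_zero.mpr hi)
  obtain ⟨K, hK⟩ := exists_nat_gt (1 / |x i - y i|)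
  filter_upwards [eventually_ge_atTop K] with k hk heq
  have h1 := Int.abs_sub_lt_one_of_floor_eq_floor (congrFun heq i)
  have hk' : (K : ℝ) ≤ k := by exact_mod_cast hk
  have hk0 : (0 : ℝ) ≤ k + 1 := by positivity
  rw [← mul_sub, abs_mul, abs_of_nonneg hk0] at h1
  rw [div_lt_iff₀ hpos] at hK
  nlinarith

/-- The vertices none of whose neighbors lies in the same cell of the grid. -/
def separatedVerts (V : Set (Fin n → ℝ)) (G : Set ((Fin n → ℝ) × (Fin n → ℝ))) (k : ℕ) :
    Set (Fin n → ℝ) :=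
  {x | x ∈ V ∧ ∀ y, (x, y) ∈ G → gridCode k x ≠ gridCode k y}

theorem definable_separatedVerts (hL : IsOMinimalExpansion L) {V : Set (Fin n → ℝ)}
    {G : Set ((Fin n → ℝ) × (Fin n → ℝ))} (hG : IsDefinableGraph L V G)
    (hV : Bornology.IsBounded V) (k : ℕ) : IsDefinableSet L (separatedVerts V G k) := by
  -- The deleted vertices are sorted by cell; finitely many cells meet `V`.
  have h : ∀ m : Fin n → ℤ, IsDefinableSet L ({x : Fin n → ℝ | gridCode k x = m} ∩
      {x | ∃ y, (x, y) ∈ G ∧ gridCode k y = m}) := fun m =>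
    (definable_gridCode_eq hL k m).inter
      (hG.definable_edges.inter
        ((definable_gridCode_eq hL k m).preimage_comp Sum.inr)).exists_of_finite
  convert! hG.definable_verts.sdiff
    (definable_biUnion_finset h (finite_gridCode_image hV k).toFinset) using 1
  ext x
  refine and_congr_right fun hx => ?_
  simp only [mem_iUnion]
  constructor
  · rintro hxs ⟨m, -, hxm, y, hxy, hym⟩
    exact hxs y hxy (Eq.trans hxm hym.symm)
  · intro hx' y hxy heq
    exact hx' ⟨gridCode k x, (finite_gridCode_image hV k).mem_toFinset.mpr ⟨x, hx, rfl⟩, rfl,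
      y, hxy, heq.symm⟩

theorem eventually_mem_separatedVerts {V : Set (Fin n → ℝ)}
    {G : Set ((Fin n → ℝ) × (Fin n → ℝ))} (hG : IsDefinableGraph L V G) {x : Fin n → ℝ}
    (hx : x ∈ V) (hdeg : {y | (x, y) ∈ G}.Finite) :
    ∀ᶠ k in atTop, x ∈ separatedVerts V G k := by
  have h : ∀ᶠ k : ℕ in atTop, ∀ y ∈ {y | (x, y) ∈ G}, gridCode k x ≠ gridCode k y := by
    rw [eventually_all_finite hdeg]
    rintro y hy
    refine eventually_gridCode_ne ?_
    rintro rfl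
    exact hG.irrefl x hy
  exact h.mono fun k hk => ⟨hx, hk⟩

theorem tendsto_volume_diff_separatedVerts (hL : IsOMinimalExpansion L) {V : Set (Fin n → ℝ)}
    {G : Set ((Fin n → ℝ) × (Fin n → ℝ))} (hG : IsDefinableGraph L V G)
    (hV : Bornology.IsBounded V) (hdeg : ∀ x ∈ V, {y | (x, y) ∈ G}.Finite) :
    Tendsto (fun k => volume (V \ separatedVerts V G k)) atTop (𝓝 0) := by
  rw [← measure_empty (μ := (volume : Measure (Fin n → ℝ)))]
  refine tendsto_measure_of_tendsto_indicator atTop (B := V) (fun k =>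
    measurableSet_of_definable hL (hG.definable_verts.sdiff (definable_separatedVerts hL hG hV k)))
    (measurableSet_of_definable hL hG.definable_verts) hV.measure_lt_top.ne
    (Eventually.of_forall fun k => sdiff_subset) fun x => ?_
  by_cases hx : x ∈ V
  · filter_upwards [eventually_mem_separatedVerts hG hx (hdeg x hx)] with k hk
    exact iff_of_false (fun h => h.2 hk) (notMem_empty x)
  · exact Eventually.of_forall fun k => iff_of_false (fun h => hx h.1) (notMem_empty x)

theorem IsDefinableGraph.induce {V V' : Set (Fin n → ℝ)}
    {G : Set ((Fin n → ℝ) × (Fin n → ℝ))} (hG : IsDefinableGraph L V G)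
    (hne : V'.Nonempty) (hV' : IsDefinableSet L V') :
    IsDefinableGraph L V' (G ∩ V' ×ˢ V') where
  nonempty := hne
  subset := inter_subset_right
  symm x y h := ⟨hG.symm x y h.1, h.2.2, h.2.1⟩
  irrefl x h := hG.irrefl x h.1
  definable_verts := hV'
  definable_edges := hG.definable_edges.inter
    ((hV'.preimage_comp Sum.inl).inter (hV'.preimage_comp Sum.inr))

theorem isDefinableColoring_gridCode (hL : IsOMinimalExpansion L) {V : Set (Fin n → ℝ)}
    {G : Set ((Fin n → ℝ) × (Fin n → ℝ))} (hG : IsDefinableGraph L V G)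
    (hV : Bornology.IsBounded V) (k : ℕ) :
    IsDefinableColoring L (separatedVerts V G k)
      (G ∩ separatedVerts V G k ×ˢ separatedVerts V G k)
      ((fun m i => (m i : ℝ)) '' (gridCode k '' V)) (fun x i => (gridCode k x i : ℝ)) where
  finite := (finite_gridCode_image hV k).image _
  mapsTo x hx := ⟨_, ⟨x, hx.1, rfl⟩, rfl⟩
  definable := by
    -- The color is constant on each cell, so the graph of the coloring is a finite union of
    -- products of a definable set with a point.
    have h : ∀ m : Fin n → ℤ, IsDefinableSet L {z : Fin n ⊕ Fin n → ℝ |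
        ((fun i => z (Sum.inl i)) ∈ separatedVerts V G k ∧
          gridCode k (fun i => z (Sum.inl i)) = m) ∧ ∀ i, z (Sum.inr i) = m i} := fun m => by
      convert! (((definable_separatedVerts hL hG hV k).inter
        (definable_gridCode_eq hL k m)).preimage_comp (Sum.inl : Fin n → Fin n ⊕ Fin n)).inter
        (definable_iInter_of_finite fun i : Fin n =>
          definable_eq_const hL (Sum.inr i : Fin n ⊕ Fin n) (m i : ℝ)) using 1
      ext z
      refine and_congr Iff.rfl ?_
      rw [mem_iInter]
      rfl
    have h' := definable_biUnion_finset h (finite_gridCode_image hV k).toFinset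
    unfold IsDefinableMapOn IsDefinableRel IsDefinableSet
    convert! h' using 1
    ext z
    simp only [mem_iUnion]
    constructor
    · rintro ⟨hz, hz'⟩
      exact ⟨_, (finite_gridCode_image hV k).mem_toFinset.mpr ⟨_, hz.1, rfl⟩, ⟨hz, rfl⟩,
        congrFun hz'⟩
    · rintro ⟨m, -, ⟨hz, rfl⟩, hz'⟩
      exact ⟨hz, funext hz'⟩
  proper x y h heq := h.2.1.2 y h.1 (funext fun i => Int.cast_injective (congrFun heq i))

end Grid

end OMinimal

theorem mainTheorem7 (L : FirstOrder.Language.{u, v}) [L.Structure ℝ] (hL : IsOMinimalExpansion L)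
    (n : ℕ) (V : Set (Fin n → ℝ)) (G : Set ((Fin n → ℝ) × (Fin n → ℝ)))
    (hG : IsDefinableGraph L V G) (hV : Bornology.IsBounded V)
    (hdeg : ∀ x ∈ V, {y | (x, y) ∈ G}.Finite) (ε : ℝ) (hε : 0 < ε) :
    ∃ V' : Set (Fin n → ℝ), V' ⊆ V ∧ volume (V \ V') < ENNReal.ofReal ε ∧
      IsDefinableGraph L V' (G ∩ V' ×ˢ V') ∧
      ∃ (m : ℕ) (X : Set (Fin m → ℝ)) (c : (Fin n → ℝ) → (Fin m → ℝ)),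
        IsDefinableColoring L V' (G ∩ V' ×ˢ V') X c := by
  obtain ⟨x, hx⟩ := hG.nonempty
  -- The measure bound alone could leave no vertices, for instance when `V` is null, so `k` is also
  -- taken large enough to keep the vertex `x`.
  obtain ⟨k, hk, hxk⟩ := (((OMinimal.tendsto_volume_diff_separatedVerts hL hG hV hdeg).eventually
    (gt_mem_nhds (ENNReal.ofReal_pos.mpr hε))).and
    (OMinimal.eventually_mem_separatedVerts hG hx (hdeg x hx))).exists
  exact ⟨OMinimal.separatedVerts V G k, fun y hy => hy.1, hk,
    OMinimal.IsDefinableGraph.induce hG ⟨x, hxk⟩ (OMinimal.definable_separatedVerts hL hG hV k),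
    n, _, _, OMinimal.isDefinableColoring_gridCode hL hG hV k⟩
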